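/- A family $F$ of subsets of $\omega$ is centered if every finite subfamily has infinite intersection; an infinite pseudointersection of $F$ is an infinite $P\subseteq\omega$ with $P\subseteq^* A$ (i.e. $P\setminus A$ finite) for every $A\in F$; and $\mathfrak p$ is the least cardinality of a centered family with no infinite pseudointersection. Order $2^{<\mathfrak p}=\bigcup_{\alpha<\mathfrak p}2^\alpha$ by extension and let $l(t)$ denote the length of $t$. A set $T\subseteq 2^{<\mathfrak p}$ is an acceptable tree if (1) every $t\in T$ other than possibly $\emptyset$ has successor length; (2) if $s\in T$ and $\alpha+1\le l(s)$, then $s\restriction(\alpha+1)\in T$; (3) for every $t$, $t^\frown 0\in T$ if and only if $t^\frown 1\in T$. Let $\{a_t:t\in 2^{<\mathfrak p}\}$ be any family of infinite subsets of $\omega$ obtained by the following recursion: $a_\emptyset=\omega$; if $l(s)$ is a limit ordinal, $a_s$ is an infinite pseudointersection of $\{a_t:t<s\}$; and for every $t\in 2^{<\mathfrak p}$ there are an infinite pseudointersection $P$ of $\{a_r:r\le t\}$ and an infinite $P'\subseteq P$ with $P\setminus P'$ infinite such that $a_{t^\frown 0}=P'$ and $a_{t^\frown 1}=\omega\setminus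 P'$. Then for every acceptable tree $T\subseteq 2^{<\mathfrak p}$, the Stone space (the space of all ultrafilters) of the Boolean subalgebra of $\mathcal P(\omega)$ generated by $\{a_t:t\in T\}$ together with all finite subsets of $\omega$ is sequentially compact. -/

import Mathlib

open Set

/-- A transfinite binary sequence: an element of `2 ^ α` with `α = len`.
The values at positions `≥ len` carry no information and are normalised to `false`, so that two
sequences are equal iff they have the same length and agree below it. -/
@[ext]
structure BinSeq where
  len : Ordinal.{0}
  val : Ordinal.{0} → Bool
  val_of_le : ∀ β, len ≤ β → val β = false

namespace BinSeq

/-- The empty sequence. -/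
def root : BinSeq where
  len := 0
  val := fun _ => false
  val_of_le := fun _ _ => rfl

/-- `s.IsPrefix t` : the sequence `t` extends `s` (as functions, `s ⊆ t`). -/
def IsPrefix (s t : BinSeq) : Prop :=
  s.len ≤ t.len ∧ ∀ β < s.len, s.val β = t.val β

/-- `s.IsProperPrefix t` : the strict tree order `s < t`. -/
def IsProperPrefix (s t : BinSeq) : Prop :=
  s.IsPrefix t ∧ s.len < t.len

open Classical in
/-- The sequence `t ⌢ i`, of length `t.len + 1`. -/
noncomputable def snoc (t : BinSeq) (i : Bool) : BinSeq where
  len := t.len + 1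
  val := fun β => if β = t.len then i else t.val β
  val_of_le := by
    intro β hβ
    have h : t.len < β := Order.add_one_le_iff.mp hβ
    rw [if_neg (ne_of_gt h)]
    exact t.val_of_le β h.le

end BinSeq

/-- `2 ^ {< κ}` : the binary sequences whose length is an ordinal below `κ`. -/
def binTree (κ : Cardinal.{0}) : Set BinSeq :=
  {t | t.len < κ.ord}

/-- Acceptable subtrees of `2 ^ {< κ}`. All nodes other than the root have successor length; the
root, which always carries the label `univ`, may or may not be counted as a node. -/
structure IsAcceptableTree (κ : Cardinal.{0}) (T : Set BinSeq) : Prop where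
  subset : T ⊆ binTree κ
  succ_len : ∀ t ∈ T, t = BinSeq.root ∨ ∃ α, t.len = α + 1
  restrict_mem : ∀ s ∈ T, ∀ r : BinSeq, r.IsPrefix s → (∃ α, r.len = α + 1) → r ∈ T
  snoc_mem_iff : ∀ t : BinSeq, t.snoc false ∈ T ↔ t.snoc true ∈ T

/-- Almost inclusion `A ⊆* B`. -/
def AlmostSubset (A B : Set ℕ) : Prop :=
  (A \ B).Finite

/-- A family of subsets of `ℕ` is centered if all its finite subfamilies have infinite
intersection. -/
def IsCentered (F : Set (Set ℕ)) : Prop :=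
  ∀ S ⊆ F, S.Finite → (⋂₀ S).Infinite

/-- `P` is an infinite pseudointersection of the family `F`. -/
def IsPseudoInter (P : Set ℕ) (F : Set (Set ℕ)) : Prop :=
  P.Infinite ∧ ∀ A ∈ F, AlmostSubset P A

/-- The pseudointersection number `𝔭`. -/
noncomputable def pseudoNumber : Cardinal.{0} :=
  sInf {κ | ∃ F : Set (Set ℕ), Cardinal.mk F = κ ∧ IsCentered F ∧ ¬ ∃ P, IsPseudoInter P F}

/-- `a` is one of the labelings of `2 ^ {< 𝔭}` obtained by choosing pseudointersections along the
tree. Values of `a` at sequences of length `≥ 𝔭` are irrelevant. -/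
structure IsPseudoLabeling (a : BinSeq → Set ℕ) : Prop where
  root : a BinSeq.root = univ
  limit : ∀ s ∈ binTree pseudoNumber, Order.IsSuccLimit s.len →
    IsPseudoInter (a s) (a '' {t | t.IsProperPrefix s})
  succ : ∀ t ∈ binTree pseudoNumber,
    ∃ P P' : Set ℕ, IsPseudoInter P (a '' {r | r.IsPrefix t}) ∧
      P' ⊆ P ∧ P'.Infinite ∧ (P \ P').Infinite ∧
      a (t.snoc false) = P' ∧ a (t.snoc true) = P'ᶜ

/-- The algebra of subsets of `ℕ` generated by the labels `a t`, `t ∈ T`, together with all finite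
sets. -/
def treeAlgebra (T : Set BinSeq) (a : BinSeq → Set ℕ) : BooleanSubalgebra (Set ℕ) :=
  BooleanSubalgebra.closure ({s | s.Finite} ∪ a '' T)

/-- The points of the Stone space of a Boolean algebra: its ultrafilters. -/
@[ext]
structure StoneSpace (B : Type*) [BooleanAlgebra B] where
  carrier : Set B
  top_mem : ⊤ ∈ carrier
  bot_notMem : ⊥ ∉ carrier
  inf_mem : ∀ x ∈ carrier, ∀ y ∈ carrier, x ⊓ y ∈ carrier
  mem_of_le : ∀ x ∈ carrier, ∀ y, x ≤ y → y ∈ carrier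
  mem_or_compl_mem : ∀ x, x ∈ carrier ∨ xᶜ ∈ carrier

/-- The Stone topology, generated by the sets `{u | x ∈ u}`. -/
instance StoneSpace.instTopologicalSpace (B : Type*) [BooleanAlgebra B] :
    TopologicalSpace (StoneSpace B) :=
  TopologicalSpace.generateFrom (range fun x : B => {u : StoneSpace B | x ∈ u.carrier})

/-! Every sequence of ultrafilters needs a subsequence that eventually settles each element of the
algebra; settling the generators is enough. Extend the terms to ultrafilters `v n` on `ℕ`. If one
singleton lies in infinitely many `v n`, those terms are all the same principal ultrafilter.
Otherwise `X ⊆* Y` implies `{n | X ∈ v n} ⊆* {n | Y ∈ v n}`, so the index sets `c t = {n | a t ∈ v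
n}` inherit the almost inclusions of the labels (`comap`), and it remains to find an infinite set
deciding all of them (`exists_decides`).

If there were none, every infinite set would be split at a node of least length
(`exists_first_split`). Splitting repeatedly and keeping the 0-half yields an ascending branch with
limit `s`. One point from each discarded half, chosen outside `c s`, gives an infinite `Q` almost
inside every label of `T` below `s` and disjoint from `c s`. The first property decides the nodes
not extending `s` (`isPrefix_or_decides`), the second those extending it: a contradiction. -/

namespace BinSeq

/-! ### Prefixes, branching and limits of binary sequences -/

theorem IsPrefix.refl (t : BinSeq) : t.IsPrefix t := ⟨le_rfl, fun _ _ => rfl⟩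

theorem IsPrefix.trans {r s t : BinSeq} (h : r.IsPrefix s) (h' : s.IsPrefix t) : r.IsPrefix t :=
  ⟨h.1.trans h'.1, fun β hβ => (h.2 β hβ).trans (h'.2 β (hβ.trans_le h.1))⟩

@[simp] theorem len_snoc (t : BinSeq) (i : Bool) : (t.snoc i).len = t.len + 1 := rfl

theorem snoc_val_len (t : BinSeq) (i : Bool) : (t.snoc i).val t.len = i := if_pos rfl

theorem snoc_val_of_lt (t : BinSeq) (i : Bool) {β : Ordinal.{0}} (h : β < t.len) :
    (t.snoc i).val β = t.val β := if_neg h.ne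

theorem isPrefix_snoc (t : BinSeq) (i : Bool) : t.IsPrefix (t.snoc i) :=
  ⟨(Order.lt_add_one_iff.2 le_rfl).le, fun _ hβ => (snoc_val_of_lt t i hβ).symm⟩

/-- The restriction of a sequence to the ordinals below `α`. -/
noncomputable def take (t : BinSeq) (α : Ordinal.{0}) : BinSeq where
  len := min α t.len
  val := open Classical in fun β => if β < α then t.val β else false
  val_of_le := by
    intro β hβ
    split_ifs with h
    · exact t.val_of_le β ((min_le_iff.1 hβ).resolve_left h.not_ge)
    · rfl

theorem take_val_of_lt (t : BinSeq) {α β : Ordinal.{0}} (h : β < α) :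
    (t.take α).val β = t.val β := if_pos h

theorem snoc_isPrefix_of_forall {r t : BinSeq} {i : Bool} (hlen : r.len < t.len)
    (h : ∀ β < r.len, r.val β = t.val β) (hi : t.val r.len = i) : (r.snoc i).IsPrefix t := by
  refine ⟨Order.add_one_le_iff.2 hlen, fun β hβ => ?_⟩
  rcases (Order.lt_add_one_iff.1 hβ).lt_or_eq with h1 | rfl
  · rw [snoc_val_of_lt r i h1, h β h1]
  · rw [snoc_val_len, hi]

theorem take_snoc_isPrefix (t : BinSeq) {α : Ordinal.{0}} (h : α < t.len) :
    ((t.take α).snoc (t.val α)).IsPrefix t := by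
  have hl : (t.take α).len = α := min_eq_left h.le
  refine snoc_isPrefix_of_forall (hl.trans_lt h) (fun β hβ => ?_) (by rw [hl])
  exact take_val_of_lt t (hβ.trans_eq hl)

/-- Prefixes of the same length as the whole sequence are equal to it. -/
theorem IsPrefix.eq_of_len_eq {s t : BinSeq} (h : s.IsPrefix t) (hl : s.len = t.len) : s = t := by
  refine BinSeq.ext hl (funext fun β => ?_)
  rcases lt_or_ge β s.len with hβ | hβ
  · exact h.2 β hβ
  · rw [s.val_of_le β hβ, t.val_of_le β (hl ▸ hβ)]

theorem exists_eq_snoc {t : BinSeq} {α : Ordinal.{0}} (h : t.len = α + 1) :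
    ∃ (r : BinSeq) (i : Bool), t = r.snoc i := by
  have hα : α < t.len := h ▸ Order.lt_add_one_iff.2 le_rfl
  refine ⟨t.take α, t.val α, ((take_snoc_isPrefix t hα).eq_of_len_eq ?_).symm⟩
  rw [len_snoc, h]
  exact congrArg (· + 1) (min_eq_left hα.le)

/-- Either `p` is a prefix of `q`, or `p` leaves `q` at some node `r`. -/
theorem isPrefix_or_exists_snoc (p q : BinSeq) :
    p.IsPrefix q ∨ ∃ (r : BinSeq) (i : Bool), (r.snoc i).IsPrefix p ∧ (r = q ∨ (r.snoc (!i)).IsPrefix q) := by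
  by_cases hd : ∃ β, β < p.len ∧ β < q.len ∧ p.val β ≠ q.val β
  · obtain ⟨β, ⟨hp, hq, hne⟩, hmin⟩ := WellFounded.has_min (wellFounded_lt (α := Ordinal.{0}))
      {β | β < p.len ∧ β < q.len ∧ p.val β ≠ q.val β} hd
    have hl : (p.take β).len = β := min_eq_left hp.le
    refine Or.inr ⟨p.take β, p.val β, take_snoc_isPrefix p hp, Or.inr ?_⟩
    refine snoc_isPrefix_of_forall (hl.trans_lt hq) (fun γ hγ => ?_) ?_
    · rw [hl] at hγ
      rw [take_val_of_lt p hγ]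
      by_contra hne'
      exact hmin γ ⟨hγ.trans hp, hγ.trans hq, hne'⟩ hγ
    · rw [hl]
      cases h1 : p.val β <;> cases h2 : q.val β <;> simp_all
  · push Not at hd
    rcases le_or_gt p.len q.len with hl | hl
    · exact Or.inl ⟨hl, fun β hβ => hd β hβ (hβ.trans_le hl)⟩
    · exact Or.inr ⟨q, p.val q.len,
        snoc_isPrefix_of_forall hl (fun β hβ => (hd β (hβ.trans hl) hβ).symm) rfl, Or.inl rfl⟩

/-- A strictly increasing sequence of nodes has a least upper bound, of limit length. -/
theorem exists_limit (t : ℕ → BinSeq) (ht : ∀ n, ((t n).snoc false).IsPrefix (t (n + 1))) :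
    ∃ s : BinSeq, Order.IsSuccLimit s.len ∧ (∀ n, (t n).IsProperPrefix s) ∧
      ∀ (r : BinSeq) (i : Bool), (r.snoc i).IsPrefix s → ∃ n, (r.snoc i).IsPrefix (t n) := by
  classical
  have hstep : ∀ n, (t n).IsPrefix (t (n + 1)) := fun n => (isPrefix_snoc _ _).trans (ht n)
  have hlt : ∀ n, (t n).len < (t (n + 1)).len := fun n => Order.add_one_le_iff.1 (ht n).1
  have hmono : ∀ m n, m ≤ n → (t m).IsPrefix (t n) := fun m n h =>
    Nat.le_induction (IsPrefix.refl _) (fun k _ ih => ih.trans (hstep k)) n h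
  have hagree : ∀ m n β, β < (t m).len → β < (t n).len → (t m).val β = (t n).val β := by
    intro m n β hm hn
    rcases le_total m n with h | h
    · exact (hmono m n h).2 β hm
    · exact ((hmono n m h).2 β hn).symm
  let s : BinSeq :=
    { len := ⨆ n, (t n).len
      val := fun β => if h : ∃ n, β < (t n).len then (t h.choose).val β else false
      val_of_le := by
        intro β hβ
        refine dif_neg ?_
        rintro ⟨n, hn⟩
        exact (hn.trans_le ((Ordinal.le_iSup (fun n => (t n).len) n).trans hβ)).false }
  have hle : ∀ n, (t n).len ≤ s.len := fun n => Ordinal.le_iSup (fun n => (t n).len) n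
  have hsub : ∀ β, β < s.len → ∃ n, β < (t n).len := fun β hβ => Ordinal.lt_iSup_iff.1 hβ
  have hval : ∀ n β, β < (t n).len → s.val β = (t n).val β := by
    intro n β hβ
    have h : ∃ n, β < (t n).len := ⟨n, hβ⟩
    exact (dif_pos h).trans (hagree _ _ β h.choose_spec hβ)
  refine ⟨s, ?_, fun n => ⟨⟨hle n, fun β hβ => (hval n β hβ).symm⟩,
    (hlt n).trans_le (hle _)⟩, ?_⟩
  · refine ⟨?_, ?_⟩
    · intro hmin
      exact absurd (hmin (zero_le : (0 : Ordinal.{0}) ≤ s.len))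
        (((zero_le).trans_lt (hlt 0)).trans_le (hle 1)).not_ge
    · refine Order.isSuccPrelimit_of_succ_lt fun β hβ => ?_
      obtain ⟨n, hn⟩ := hsub β hβ
      exact (Order.succ_le_of_lt hn).trans_lt ((hlt n).trans_le (hle _))
  · intro r i hr
    obtain ⟨n, hn⟩ := hsub r.len (Order.add_one_le_iff.1 hr.1)
    exact ⟨n, Order.add_one_le_iff.2 hn, fun β hβ => (hr.2 β hβ).trans
      (hval n β (hβ.trans_le (Order.add_one_le_iff.2 hn)))⟩

end BinSeq

/-! ### Almost inclusion and decided sets -/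

theorem AlmostSubset.trans {A B C : Set ℕ} (h : AlmostSubset A B) (h' : AlmostSubset B C) :
    AlmostSubset A C :=
  (h.union h').subset fun x hx => by
    by_cases hB : x ∈ B
    · exact Or.inr ⟨hB, hx.2⟩
    · exact Or.inl ⟨hx.1, hB⟩

theorem AlmostSubset.of_subset {A B : Set ℕ} (h : A ⊆ B) : AlmostSubset A B := by
  rw [AlmostSubset, sdiff_eq_empty.2 h]
  exact finite_empty

theorem AlmostSubset.compl {A B : Set ℕ} (h : AlmostSubset A B) : AlmostSubset Bᶜ Aᶜ :=
  h.subset fun _ hx => ⟨not_not.1 hx.2, hx.1⟩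

theorem AlmostSubset.inter {A B C : Set ℕ} (h : AlmostSubset A B) (h' : AlmostSubset A C) :
    AlmostSubset A (B ∩ C) := by
  rw [AlmostSubset, sdiff_inter]
  exact h.union h'

/-- `Q` is almost contained in `X` or in its complement. -/
def Decides (Q X : Set ℕ) : Prop :=
  AlmostSubset Q X ∨ AlmostSubset Q Xᶜ

theorem Decides.compl {Q X : Set ℕ} (h : Decides Q X) : Decides Q Xᶜ := by
  rw [Decides, compl_compl]
  exact h.symm

theorem decides_compl_iff {Q X : Set ℕ} : Decides Q Xᶜ ↔ Decides Q X :=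
  ⟨fun h => compl_compl X ▸ h.compl, Decides.compl⟩

theorem Decides.union {Q X Y : Set ℕ} (hX : Decides Q X) (hY : Decides Q Y) :
    Decides Q (X ∪ Y) := by
  rcases hX with hX | hX
  · exact Or.inl (hX.trans (.of_subset subset_union_left))
  rcases hY with hY | hY
  · exact Or.inl (hY.trans (.of_subset subset_union_right))
  · exact Or.inr (by rw [compl_union]; exact hX.inter hY)

/-- The almost-inclusion pattern shared by pseudointersection labelings and their pullbacks. -/
structure IsTreeSystem (κ : Cardinal.{0}) (c : BinSeq → Set ℕ) : Prop where
  root : c BinSeq.root = univ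
  limit : ∀ s ∈ binTree κ, Order.IsSuccLimit s.len →
    ∀ t : BinSeq, t.IsProperPrefix s → AlmostSubset (c s) (c t)
  snoc_false : ∀ t ∈ binTree κ, ∀ r : BinSeq, r.IsPrefix t →
    AlmostSubset (c (t.snoc false)) (c r)
  snoc_true : ∀ t ∈ binTree κ, c (t.snoc true) = (c (t.snoc false))ᶜ

theorem IsPseudoLabeling.isTreeSystem {a : BinSeq → Set ℕ} (ha : IsPseudoLabeling a) :
    IsTreeSystem pseudoNumber a where
  root := ha.root
  limit s hs hl t ht := (ha.limit s hs hl).2 _ (mem_image_of_mem a ht)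
  snoc_false t ht r hr := by
    obtain ⟨P, P', hP, hsub, -, -, h0, -⟩ := ha.succ t ht
    rw [h0]
    exact (AlmostSubset.of_subset hsub).trans (hP.2 _ (mem_image_of_mem a hr))
  snoc_true t ht := by
    obtain ⟨P, P', -, -, -, -, h0, h1⟩ := ha.succ t ht
    rw [h0, h1]

theorem mem_binTree_of_snoc {κ : Cardinal.{0}} {t : BinSeq} {i : Bool}
    (h : t.snoc i ∈ binTree κ) : t ∈ binTree κ :=
  (Order.lt_add_one_iff.2 le_rfl : t.len < t.len + 1).trans h

theorem IsAcceptableTree.snoc_mem {κ : Cardinal.{0}} {T : Set BinSeq} (hT : IsAcceptableTree κ T)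
    {t : BinSeq} {i : Bool} (h : t.snoc i ∈ T) (j : Bool) : t.snoc j ∈ T := by
  have := hT.snoc_mem_iff t
  cases i <;> cases j <;> tauto

theorem IsAcceptableTree.mem_binTree {κ : Cardinal.{0}} {T : Set BinSeq}
    (hT : IsAcceptableTree κ T) {t : BinSeq} {i : Bool} (h : t.snoc i ∈ T) : t ∈ binTree κ :=
  mem_binTree_of_snoc (hT.subset h)

/-! ### Splitting and deciding along a tree system -/

namespace IsTreeSystem

variable {κ : Cardinal.{0}} {T : Set BinSeq} {c : BinSeq → Set ℕ}

theorem snoc_not (hc : IsTreeSystem κ c) {t : BinSeq} (ht : t ∈ binTree κ) (i : Bool) :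
    c (t.snoc (!i)) = (c (t.snoc i))ᶜ := by
  cases i
  · exact hc.snoc_true t ht
  · simp [hc.snoc_true t ht]

theorem decides_snoc_iff (hc : IsTreeSystem κ c) {t : BinSeq} (ht : t ∈ binTree κ) (i : Bool)
    {Q : Set ℕ} : Decides Q (c (t.snoc i)) ↔ Decides Q (c (t.snoc false)) := by
  cases i
  · rfl
  · rw [hc.snoc_true t ht, decides_compl_iff]

/-- An infinite set that does not decide all labels is split at a node all of whose predecessors
almost contain it. -/
theorem exists_first_split (hc : IsTreeSystem κ c) (hT : IsAcceptableTree κ T) {A : Set ℕ}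
    (h : ∃ t ∈ T, ¬ Decides A (c t)) :
    ∃ t : BinSeq, t.snoc false ∈ T ∧ ¬ Decides A (c (t.snoc false)) ∧
      ∀ r ∈ T, r.IsPrefix t → AlmostSubset A (c r) := by
  have hne : ({t | t.snoc false ∈ T ∧ ¬ Decides A (c (t.snoc false))} : Set BinSeq).Nonempty := by
    obtain ⟨r, hr, hA⟩ := h
    rcases hT.succ_len r hr with rfl | ⟨α, hα⟩
    · exact absurd (Or.inl (.of_subset (hc.root ▸ subset_univ A))) hA
    · obtain ⟨t, i, rfl⟩ := BinSeq.exists_eq_snoc hα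
      exact ⟨t, hT.snoc_mem hr _, fun h => hA ((hc.decides_snoc_iff (hT.mem_binTree hr) i).2 h)⟩
  obtain ⟨t, ⟨htT, htA⟩, hmin⟩ :=
    (InvImage.wf BinSeq.len (wellFounded_lt (α := Ordinal.{0}))).has_min _ hne
  refine ⟨t, htT, htA, fun r hr hrt => ?_⟩
  rcases hT.succ_len r hr with rfl | ⟨α, hα⟩
  · exact .of_subset (hc.root ▸ subset_univ A)
  obtain ⟨q, i, rfl⟩ := BinSeq.exists_eq_snoc hα
  have hd : Decides A (c (q.snoc i)) := by
    rw [hc.decides_snoc_iff (hT.mem_binTree hr)]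
    by_contra hd
    exact hmin q ⟨hT.snoc_mem hr _, hd⟩ (Order.add_one_le_iff.1 hrt.1)
  -- If `A` were almost disjoint from this label, it would be almost disjoint from `c (t.snoc
  -- false)`, which is almost contained in it, and so would not be split at `t`.
  refine hd.resolve_right fun hA => htA (Or.inr (hA.trans ?_))
  exact (hc.snoc_false t (hT.mem_binTree htT) _ hrt).compl

/-- A set that is almost contained in the labels below `s` decides every label at a node that
does not extend `s`. -/
theorem isPrefix_or_decides (hc : IsTreeSystem κ c) (hT : IsAcceptableTree κ T) {Q : Set ℕ}
    {s : BinSeq} (hQ : ∀ (r : BinSeq) (i : Bool), r.snoc i ∈ T → (r.snoc i).IsPrefix s →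
      AlmostSubset Q (c (r.snoc i)))
    {t : BinSeq} (ht : t.snoc false ∈ T) :
    s.IsPrefix t ∨ Decides Q (c (t.snoc false)) := by
  rcases s.isPrefix_or_exists_snoc t with h | ⟨r, i, hs, rfl | hrt⟩
  · exact Or.inl h
  · exact Or.inr ((hc.decides_snoc_iff (hT.mem_binTree ht) i).1
      (Or.inl (hQ _ _ (hT.snoc_mem ht i) hs)))
  -- Here `s` and `t` part at `r`: `c (t.snoc false)` is almost inside the label on the side of `t`,
  -- and `Q` almost inside its complement.
  · have hr : r.snoc (!i) ∈ T :=
      hT.restrict_mem _ ht _ (hrt.trans (BinSeq.isPrefix_snoc _ _)) ⟨_, rfl⟩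
    have h1 := (hc.snoc_false t (hT.mem_binTree ht) _ hrt).compl
    rw [hc.snoc_not (hT.mem_binTree hr), compl_compl] at h1
    exact Or.inr (Or.inr ((hQ _ _ (hT.snoc_mem hr i) hs).trans h1))

/-- A diagonal argument: were every infinite subset of `A` split, a pseudointersection of the
successive 0-halves that avoids the label at the limit node would still be split by nothing. -/
theorem exists_decides (hc : IsTreeSystem κ c) (hT : IsAcceptableTree κ T) {A : Set ℕ}
    (hA : A.Infinite) : ∃ Q ⊆ A, Q.Infinite ∧ ∀ t ∈ T, Decides Q (c t) := by
  by_contra hcon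
  push Not at hcon
  have hsplit : ∀ X : Set ℕ, X ⊆ A ∧ X.Infinite → ∃ t : BinSeq, t.snoc false ∈ T ∧
      ¬ Decides X (c (t.snoc false)) ∧ ∀ r ∈ T, r.IsPrefix t → AlmostSubset X (c r) :=
    fun X hX => hc.exists_first_split hT (hcon X hX.1 hX.2)
  have : Nonempty BinSeq := ⟨BinSeq.root⟩
  choose! f hfT hfX hfpre using hsplit
  let S : ℕ → Set ℕ := fun n => Nat.rec A (fun _ X => X ∩ c ((f X).snoc false)) n
  let t : ℕ → BinSeq := fun n => f (S n)
  have hS_succ : ∀ n, S (n + 1) = S n ∩ c ((t n).snoc false) := fun _ => rfl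
  have hS : ∀ n, S n ⊆ A ∧ (S n).Infinite := by
    intro n
    induction n with
    | zero => exact ⟨subset_rfl, hA⟩
    | succ n ih =>
      refine ⟨inter_subset_left.trans ih.1, fun hfin => hfX _ ih (Or.inr ?_)⟩
      rw [AlmostSubset, sdiff_compl]
      exact hfin
  have htT : ∀ n, (t n).snoc false ∈ T := fun n => hfT _ (hS n)
  have hSanti : Antitone S := antitone_nat_of_succ_le fun n => inter_subset_left
  have hpre : ∀ n r, r ∈ T → r.IsPrefix (t n) → AlmostSubset (S n) (c r) :=
    fun n => hfpre _ (hS n)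
  have hinc : ∀ n, ((t n).snoc false).IsPrefix (t (n + 1)) := by
    intro n
    -- `S (n + 1)` is almost inside all labels of `T` up to `(t n).snoc false`, so it can only be
    -- split at a node above.
    refine (hc.isPrefix_or_decides hT (Q := S (n + 1)) (fun r i hr hrt => ?_)
      (htT (n + 1))).resolve_right (hfX _ (hS (n + 1)))
    rcases hrt.1.lt_or_eq with hl | hl
    · refine (AlmostSubset.of_subset inter_subset_left).trans (hpre n _ hr ⟨?_, fun β hβ => ?_⟩)
      · exact Order.lt_add_one_iff.1 hl
      · rw [hrt.2 β hβ]
        exact BinSeq.snoc_val_of_lt _ _ (hβ.trans_le (Order.lt_add_one_iff.1 hl))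
    · rw [hrt.eq_of_len_eq hl]
      exact .of_subset inter_subset_right
  obtain ⟨s, hs_lim, hts, hs_pre⟩ := BinSeq.exists_limit t hinc
  -- If `s` is too long to lie in `binTree κ`, no node of `T` extends it and nothing has to be
  -- avoided, so `∅` serves.
  obtain ⟨E, hE, hEs⟩ : ∃ E : Set ℕ, (∀ n, AlmostSubset E (c ((t n).snoc false))) ∧
      (s ∈ binTree κ → E = c s) := by
    by_cases hs : s ∈ binTree κ
    · refine ⟨c s, fun n => hc.limit s hs hs_lim _ ⟨(hinc n).trans (hts (n + 1)).1, ?_⟩,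
        fun _ => rfl⟩
      exact (hinc n).1.trans_lt (hts (n + 1)).2
    · exact ⟨∅, fun n => .of_subset (empty_subset _), fun h => absurd h hs⟩
  -- The discarded half is infinite and meets `E` in a finite set.
  have hex : ∀ n, ∃ q, q ∈ S n ∧ q ∉ c ((t n).snoc false) ∧ q ∉ E := by
    intro n
    have hinf : (S n \ c ((t n).snoc false)).Infinite := fun h => hfX _ (hS n) (Or.inl h)
    obtain ⟨q, hq, hqE⟩ := (hinf.sdiff (hE n)).nonempty
    exact ⟨q, hq.1, hq.2, fun h => hqE ⟨h, hq.2⟩⟩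
  choose q hqS hqc hqE using hex
  have hq_lt : ∀ m n, m < n → q m ≠ q n := by
    intro m n hmn heq
    have : q n ∈ S (m + 1) := hSanti hmn (hqS n)
    exact hqc m (heq ▸ this.2)
  have hq_inj : Function.Injective q := by
    intro m n h
    rcases lt_trichotomy m n with hmn | hmn | hmn
    · exact absurd h (hq_lt m n hmn)
    · exact hmn
    · exact absurd h.symm (hq_lt n m hmn)
  have hQS : ∀ n, AlmostSubset (range q) (S n) := by
    intro n
    refine ((finite_Iio n).image q).subset ?_
    rintro _ ⟨⟨m, rfl⟩, hm⟩
    exact ⟨m, not_le.1 fun h => hm (hSanti h (hqS m)), rfl⟩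
  have hbelow : ∀ (r : BinSeq) (i : Bool), r.snoc i ∈ T → (r.snoc i).IsPrefix s →
      AlmostSubset (range q) (c (r.snoc i)) := by
    intro r i hr hrs
    obtain ⟨n, hn⟩ := hs_pre r i hrs
    exact (hQS n).trans (hpre n _ hr hn)
  obtain ⟨r, hrT, hr⟩ := hcon (range q) (range_subset_iff.2 fun n => (hS n).1 (hqS n))
    (infinite_range_of_injective hq_inj)
  have hdec : ∀ t : BinSeq, t.snoc false ∈ T → Decides (range q) (c (t.snoc false)) := by
    intro p hp
    rcases hc.isPrefix_or_decides hT hbelow hp with h | h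
    -- Above `s` the label is almost inside `c s = E`, which `range q` misses.
    · have hpκ := hT.mem_binTree hp
      rw [← compl_compl (c _)]
      refine Decides.compl (Or.inl (AlmostSubset.trans ?_ (hc.snoc_false p hpκ s h).compl))
      rw [← hEs (h.1.trans_lt hpκ)]
      exact .of_subset (range_subset_iff.2 hqE)
    · exact h
  rcases hT.succ_len r hrT with rfl | ⟨α, hα⟩
  · exact hr (Or.inl (.of_subset (hc.root ▸ subset_univ _)))
  · obtain ⟨p, i, rfl⟩ := BinSeq.exists_eq_snoc hα
    exact hr ((hc.decides_snoc_iff (hT.mem_binTree hrT) i).2 (hdec p (hT.snoc_mem hrT _)))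

/-- Pulling back a tree system along a sequence of ultrafilters in which every finite set occurs
only finitely often. -/
theorem comap (hc : IsTreeSystem κ c) (v : ℕ → Ultrafilter ℕ)
    (hv : ∀ F : Set ℕ, F.Finite → {n | F ∈ v n}.Finite) :
    IsTreeSystem κ fun t => {n | c t ∈ v n} := by
  have hsub : ∀ X Y : Set ℕ, AlmostSubset X Y → AlmostSubset {n | X ∈ v n} {n | Y ∈ v n} := by
    intro X Y h
    -- Where `X ∈ v n` and `Y ∉ v n`, the finite set `X \ Y` belongs to `v n`.
    refine (hv _ h).subset fun n hn => ?_
    exact Filter.inter_mem hn.1 (Ultrafilter.compl_mem_iff_notMem.2 hn.2)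
  refine ⟨?_, fun s hs hl t ht => hsub _ _ (hc.limit s hs hl t ht),
    fun t ht r hr => hsub _ _ (hc.snoc_false t ht r hr), fun t ht => ?_⟩
  · exact eq_univ_of_forall fun n => by rw [hc.root]; exact Filter.univ_mem
  · ext n
    simp only [hc.snoc_true t ht, mem_ofPred_eq, mem_compl_iff, Ultrafilter.compl_mem_iff_notMem]

end IsTreeSystem

/-! ### Extension of ultrafilters and convergence in the Stone space -/

namespace StoneSpace

/-- Every ultrafilter of an algebra of sets extends to an ultrafilter of sets. -/
theorem exists_ultrafilter {B : BooleanSubalgebra (Set ℕ)} (u : StoneSpace B) :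
    ∃ v : Ultrafilter ℕ, ∀ x : B, x ∈ u.carrier ↔ (x : Set ℕ) ∈ v := by
  let F : Filter ℕ :=
    { sets := {X | ∃ x ∈ u.carrier, (x : Set ℕ) ⊆ X}
      univ_sets := ⟨⊤, u.top_mem, subset_univ _⟩
      sets_of_superset := fun ⟨x, hx, h⟩ h' => ⟨x, hx, h.trans h'⟩
      inter_sets := fun ⟨x, hx, h⟩ ⟨y, hy, h'⟩ =>
        ⟨x ⊓ y, u.inf_mem x hx y hy, inter_subset_inter h h'⟩ }
  have hF : F.NeBot := by
    refine ⟨fun h => ?_⟩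
    obtain ⟨x, hx, hx0⟩ : (∅ : Set ℕ) ∈ F := h ▸ Filter.mem_bot
    have : x = ⊥ := Subtype.ext (subset_empty_iff.1 hx0)
    exact u.bot_notMem (this ▸ hx)
  have hmem : ∀ x ∈ u.carrier, (x : Set ℕ) ∈ Ultrafilter.of F := fun x hx =>
    Ultrafilter.of_le F ⟨x, hx, subset_rfl⟩
  refine ⟨Ultrafilter.of F, fun x => ⟨hmem x, fun hx => ?_⟩⟩
  refine (u.mem_or_compl_mem x).resolve_right fun hx' => ?_
  exact Ultrafilter.compl_mem_iff_notMem.1 (hmem _ hx') hx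

/-- A sequence has a limit if it eventually decides each element of the algebra. -/
theorem exists_tendsto {B : Type*} [BooleanAlgebra B] (u : ℕ → StoneSpace B)
    (hu : ∀ x, (∀ᶠ n in Filter.atTop, x ∈ (u n).carrier) ∨
      ∀ᶠ n in Filter.atTop, x ∉ (u n).carrier) :
    ∃ w, Filter.Tendsto u Filter.atTop (nhds w) := by
  let w : StoneSpace B :=
    { carrier := {x | ∀ᶠ n in Filter.atTop, x ∈ (u n).carrier}
      top_mem := .of_forall fun n => (u n).top_mem
      bot_notMem := fun h => by
        obtain ⟨n, hn⟩ := h.exists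
        exact (u n).bot_notMem hn
      inf_mem := fun x hx y hy => by
        filter_upwards [hx, hy] with n h1 h2 using (u n).inf_mem x h1 y h2
      mem_of_le := fun x hx y hxy => by
        filter_upwards [hx] with n h using (u n).mem_of_le x h y hxy
      mem_or_compl_mem := fun x => (hu x).imp_right fun h => by
        filter_upwards [h] with n hn using ((u n).mem_or_compl_mem x).resolve_left hn }
  refine ⟨w, TopologicalSpace.tendsto_nhds_generateFrom_iff.2 ?_⟩
  rintro _ ⟨x, rfl⟩ hx
  exact hx

end StoneSpace

/-- Convergence criterion: some infinite set of indices decides all elements of the algebra. -/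
theorem seqCompactSpace_of_decides {B : BooleanSubalgebra (Set ℕ)}
    (h : ∀ v : ℕ → Ultrafilter ℕ, ∃ Q : Set ℕ, Q.Infinite ∧ ∀ X ∈ B, Decides Q {n | X ∈ v n}) :
    SeqCompactSpace (StoneSpace B) := by
  refine ⟨fun u _ => ?_⟩
  choose v hv using fun n => (u n).exists_ultrafilter
  obtain ⟨Q, hQ, hdec⟩ := h v
  let φ : ℕ → ℕ := Nat.nth (· ∈ Q)
  have hφ : StrictMono φ := Nat.nth_strictMono hQ
  have hφQ : ∀ n, φ n ∈ Q := fun n => Nat.nth_mem_of_infinite hQ n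
  have hev : ∀ X : Set ℕ, AlmostSubset Q X → ∀ᶠ n in Filter.atTop, φ n ∈ X := by
    intro X hX
    have hfin : (φ ⁻¹' (Q \ X)).Finite := hX.preimage hφ.injective.injOn
    have := hfin.compl_mem_cofinite
    rw [Nat.cofinite_eq_atTop] at this
    filter_upwards [this] with n hn
    by_contra hX'
    exact hn ⟨hφQ n, hX'⟩
  obtain ⟨w, hw⟩ := StoneSpace.exists_tendsto (u ∘ φ) fun x => by
    refine (hdec x x.2).imp (fun hx => ?_) fun hx => ?_
    · filter_upwards [hev _ hx] with n hn using (hv _ x).2 hn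
    · filter_upwards [hev _ hx] with n hn using fun h => hn ((hv _ x).1 h)
  exact ⟨w, mem_univ _, φ, hφ, hw⟩

theorem mainTheorem7 (T : Set BinSeq) (hT : IsAcceptableTree pseudoNumber T)
    (a : BinSeq → Set ℕ) (ha : IsPseudoLabeling a) :
    SeqCompactSpace (StoneSpace (treeAlgebra T a)) := by
  refine seqCompactSpace_of_decides fun v => ?_
  by_cases hk : ∃ k : ℕ, {n | {k} ∈ v n}.Infinite
  · obtain ⟨k, hk⟩ := hk
    refine ⟨_, hk, fun X _ => ?_⟩
    by_cases hX : k ∈ X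
    · exact Or.inl (.of_subset fun n hn =>
        Filter.mem_of_superset hn (singleton_subset_iff.2 hX))
    · refine Or.inr (.of_subset fun n hn => Ultrafilter.compl_mem_iff_notMem.1 ?_)
      exact Filter.mem_of_superset hn (singleton_subset_iff.2 hX)
  · push Not at hk
    have hfin : ∀ F : Set ℕ, F.Finite → {n | F ∈ v n}.Finite := by
      intro F hF
      refine (hF.biUnion fun k _ => hk k).subset fun n hn => ?_
      -- An ultrafilter containing a finite set is principal at one of its points.
      obtain ⟨k, hkF, hkn⟩ := (Ultrafilter.eq_pure_of_finite_mem hF hn)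
      exact mem_biUnion hkF (by rw [mem_ofPred_eq, hkn]; exact rfl)
    obtain ⟨Q, -, hQ, hdec⟩ :=
      (ha.isTreeSystem.comap v hfin).exists_decides hT infinite_univ
    refine ⟨Q, hQ, fun X hX => ?_⟩
    refine BooleanSubalgebra.closure_bot_sup_induction
      (p := fun X _ => Decides Q {n | X ∈ v n}) ?_ ?_ ?_ ?_ hX
    · rintro X (hX | ⟨t, ht, rfl⟩)
      · exact Or.inr ((hfin X hX).subset fun n hn => not_not.1 hn.2)
      · exact hdec t ht
    · refine Or.inr (.of_subset fun n _ hn => (v n).empty_notMem hn)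
    · intro X _ Y _ hX hY
      have : {n | X ⊔ Y ∈ v n} = {n | X ∈ v n} ∪ {n | Y ∈ v n} := by
        ext n
        exact Ultrafilter.union_mem_iff
      rw [this]
      exact hX.union hY
    · intro X _ hX
      have : {n | Xᶜ ∈ v n} = {n | X ∈ v n}ᶜ := by
        ext n
        exact Ultrafilter.compl_mem_iff_notMem
      rw [this]
      exact hX.compl
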